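/- **Conventions.** Diagrams of 4-braids are read from top to bottom, with strand positions $0,1,2,3$; $\sigma_1$ (resp. $\sigma_2$) denotes the crossing of the strands in positions $1,2$ (resp. $2,3$) in which the strand from upper right to lower left is the overstrand (so it is a positive crossing when both strands point down). For a 4-braid word $w$ let $q_4(w)$ be the 2-tangle, with its four endpoints at the top, formed by $w$ and two unlinked arcs joining the bottom ends $0,1$ and $2,3$; its plat closure $p_4(w)$ is obtained by joining the top ends $0,1$ and $2,3$ by unlinked arcs. The HOMFLY polynomial $P\in\mathbb Z[a^{\pm1},m^{\pm1}]$ of oriented links is the isotopy invariant with $P(\text{unknot})=1$ and $aP(L_+)+a^{-1}P(L_-)+mP(L_0)=0$. The HOMFLY bracket $\langle T\rangle$ of an oriented 2-tangle $T$ is its class in the $\mathbb Z[a^{\pm1},m^{\pm1}]$-module generated by the oriented tangles with the same oriented endpoints, modulo isotopy fixing the endpoints and the relation $a\langle T_+\rangle+a^{-1}\langle T_-\rangle+m\langle T_0'\rangle=0$ for tangles that differ at one crossing (a positive crossing, a negative crossing, the oriented smoothing). Let $T_0$ be the tangle without crossings whose arcs join the endpoints $1,2$ and $0,3$; let $T_\infty=q_4(1)$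 and $T_x=q_4(\sigma_1)$. They carry the orientation of the endpoints of the tangle under consideration; $\langle T\rangle$ is read as $0$ for those of them to which this orientation does not extend. **Theorem.** Let $n\ge1$, let $\epsilon_1,\dots,\epsilon_{2n-1}$ be positive integers, $w=\sigma_1^{\epsilon_1}\sigma_2^{-\epsilon_2}\sigma_1^{\epsilon_3}\cdots\sigma_1^{\epsilon_{2n-1}}$, and let $T_w=q_4(w)$ be given any orientation. Put $k_i=1$ if the two strands that cross in the $i$-th syllable of $w$ are parallel (both pointing down or both up) there, and $k_i=2$ otherwise. Let $$A^1_1=\begin{pmatrix}1&0&0\\0&0&-a^{-2}\\0&1&-a^{-1}m\end{pmatrix},\quad A^1_2=\begin{pmatrix}1&0&-am\\0&0&-a^{2}\\0&1&0\end{pmatrix},\quad B^{-1}_1=\begin{pmatrix}0&0&-a^2\\0&1&0\\1&0&-am\end{pmatrix},\quad B^{-1}_2=\begin{pmatrix}0&0&-a^{-2}\\0&1&-a^{-1}m\\1&0&0\end{pmatrix},$$ $$M=(A^1_{k_1})^{\epsilon_1}(B^{-1}_{k_2})^{\epsilon_2}(A^1_{k_3})^{\epsilon_3}\cdots(A^1_{k_{2n-1}})^{\epsilon_{2n-1}},$$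 and let $[f\ g\ h]=[0\ 1\ 0]\,M^t$, the second column of $M$. Then $$\langle T_w\rangle=f\,\langle T_0\rangle+g\,\langle T_\infty\rangle+h\,\langle T_x\rangle ,$$ and the coefficient of each of $T_0,T_\infty,T_x$ to which the orientation of the endpoints does not extend is $0$. Moreover, if the orientation extends to the plat closure $K=p_4(w)$, then $$P(K)=f-g\,\frac{a+a^{-1}}{m}+h ,$$ and likewise, in the corresponding module of oriented links, $\langle K\rangle=\bigl(f-g\,\tfrac{a+a^{-1}}{m}+h\bigr)\langle\text{unknot}\rangle$. -/

import Mathlib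

/-!
Oriented tangle diagrams in sliced (Morse) form, read from top to bottom, their isotopy,
the HOMFLY skein module, 4-plats, and the 3 by 3 matrices of the HOMFLY bracket.
-/

namespace HomflySkein

/-- The local orientation of a strand: `true` is downward, `false` is upward. -/
abbrev Sign := Bool

/-- Elementary oriented pieces of a diagram.
* `cross e s t`: the strand entering at the upper left has sign `s` and leaves at the lower right,
  the strand entering at the upper right has sign `t` and leaves at the lower left.
  If `e = true` (the braid generator `σ`) the strand between upper right and lower left is the
  overstrand; if `e = false` (the inverse `σ⁻¹`) it is the understrand.
* `birth s`: a local maximum, creating two strands with signs `s`, `!s`.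
* `death s`: a local minimum, joining two strands with signs `s`, `!s`. -/
inductive Piece : Type
  | cross (e : Bool) (s t : Sign)
  | birth (s : Sign)
  | death (s : Sign)

/-- Signs at the top of a piece. -/
def Piece.src : Piece → List Sign
  | .cross _ s t => [s, t]
  | .birth _ => []
  | .death s => [s, !s]

/-- Signs at the bottom of a piece. -/
def Piece.tgt : Piece → List Sign
  | .cross _ s t => [t, s]
  | .birth s => [s, !s]
  | .death _ => []

/-- A horizontal slice: one piece, with vertical strands to its left and right. -/
structure Layer where
  left : List Sign
  piece : Piece
  right : List Sign

def Layer.src (L : Layer) : List Sign := L.left ++ L.piece.src ++ L.right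

def Layer.tgt (L : Layer) : List Sign := L.left ++ L.piece.tgt ++ L.right

/-- A stack of slices, the first entry of the list being the top slice. -/
abbrev Word := List Layer

/-- `IsDiagram X w Y`: the slices of `w` fit together, so that `w` is an oriented tangle diagram
with top endpoints of signs `X` and bottom endpoints of signs `Y`. -/
def IsDiagram : List Sign → Word → List Sign → Prop
  | X, [], Y => X = Y
  | X, L :: w, Y => X = L.src ∧ IsDiagram L.tgt w Y

/-- Oriented tangle diagrams from `X` to `Y`; oriented link diagrams are `Diagram [] []`. -/
abbrev Diagram (X Y : List Sign) := {w : Word // IsDiagram X w Y}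

/-- Add vertical strands to the left and to the right. -/
def whisker (l r : List Sign) (w : Word) : Word :=
  w.map fun L => ⟨l ++ L.left, L.piece, L.right ++ r⟩

/-- The word `u`, between strands `l` and `r`, placed below `p` and above `q`. -/
def plug (p : Word) (l r : List Sign) (q u : Word) : Word := p ++ whisker l r u ++ q

/-- The local moves generating isotopy of sliced oriented tangle diagrams, relative to the
endpoints. -/
inductive LocalMove : Word → Word → Prop
  /-- distant pieces may change heights -/
  | interchange (g h : Piece) (m : List Sign) :
      LocalMove [⟨[], g, m ++ h.src⟩, ⟨g.tgt ++ m, h, []⟩]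
        [⟨g.src ++ m, h, []⟩, ⟨[], g, m ++ h.tgt⟩]
  /-- cancellation of a maximum and a minimum -/
  | zigzag_right (s : Sign) :
      LocalMove [⟨[s], .birth (!s), []⟩, ⟨[], .death s, [s]⟩] []
  | zigzag_left (s : Sign) :
      LocalMove [⟨[], .birth s, [s]⟩, ⟨[s], .death (!s), []⟩] []
  /-- a strand passes over or under a minimum -/
  | slide_death (e : Bool) (s t : Sign) :
      LocalMove [⟨[], .cross e s t, [!s]⟩, ⟨[t], .death s, []⟩]
        [⟨[s], .cross (!e) t (!s), []⟩, ⟨[], .death s, [t]⟩]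
  /-- a strand passes over or under a maximum -/
  | slide_birth (e : Bool) (s t : Sign) :
      LocalMove [⟨[t], .birth s, []⟩, ⟨[], .cross e t s, [!s]⟩]
        [⟨[], .birth s, [t]⟩, ⟨[s], .cross (!e) (!s) t, []⟩]
  /-- first Reidemeister move -/
  | r1_birth (e : Bool) (s : Sign) :
      LocalMove [⟨[], .birth s, []⟩, ⟨[], .cross e s (!s), []⟩] [⟨[], .birth (!s), []⟩]
  | r1_death (e : Bool) (s : Sign) :
      LocalMove [⟨[], .cross e s (!s), []⟩, ⟨[], .death (!s), []⟩] [⟨[], .death s, []⟩]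
  /-- second Reidemeister move -/
  | r2 (e : Bool) (s t : Sign) :
      LocalMove [⟨[], .cross e s t, []⟩, ⟨[], .cross (!e) t s, []⟩] []
  /-- third Reidemeister move -/
  | r3 (e : Bool) (s t r : Sign) :
      LocalMove [⟨[], .cross e s t, [r]⟩, ⟨[t], .cross e s r, []⟩, ⟨[], .cross e t r, [s]⟩]
        [⟨[s], .cross e t r, []⟩, ⟨[], .cross e s r, [t]⟩, ⟨[r], .cross e s t, []⟩]

/-- Two diagrams that differ by one local move. -/
def Step {X Y : List Sign} (D D' : Diagram X Y) : Prop :=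
  ∃ (p : Word) (l r : List Sign) (q u v : Word),
    LocalMove u v ∧ D.1 = plug p l r q u ∧ D'.1 = plug p l r q v

/-- Isotopy (relative to the endpoints) of oriented tangles, on diagrams. -/
def Isotopic {X Y : List Sign} : Diagram X Y → Diagram X Y → Prop :=
  Relation.EqvGen Step

/-- The pictures `L₊`, `L₋`, `L₀` near a crossing: a positive crossing, a negative crossing, and
the smoothing that respects the orientation. -/
inductive LocalSkein : Word → Word → Word → Prop
  /-- both strands downward or both upward -/
  | parallel (s : Sign) :
      LocalSkein [⟨[], .cross true s s, []⟩] [⟨[], .cross false s s, []⟩] []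
  /-- one strand downward, the other upward -/
  | antiparallel (s : Sign) :
      LocalSkein [⟨[], .cross false s (!s), []⟩] [⟨[], .cross true s (!s), []⟩]
        [⟨[], .death s, []⟩, ⟨[], .birth (!s), []⟩]

/-- Three diagrams that are identical except near one crossing, where they are `L₊`, `L₋`, `L₀`. -/
def SkeinTriple {X Y : List Sign} (Dp Dm Dz : Diagram X Y) : Prop :=
  ∃ (p : Word) (l r : List Sign) (q up um uz : Word), LocalSkein up um uz ∧
    Dp.1 = plug p l r q up ∧ Dm.1 = plug p l r q um ∧ Dz.1 = plug p l r q uz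

/-- The ring `ℤ[a, a⁻¹, m, m⁻¹]` of Laurent polynomials in two variables: the pair `(i, j)` of
exponents stands for the monomial `a ^ i * m ^ j`. -/
abbrev Coeff := AddMonoidAlgebra ℤ (ℤ × ℤ)

noncomputable section

def a : Coeff := AddMonoidAlgebra.single (1, 0) 1

/-- `a⁻¹` -/
def aInv : Coeff := AddMonoidAlgebra.single (-1, 0) 1

def m : Coeff := AddMonoidAlgebra.single (0, 1) 1

/-- `m⁻¹` -/
def mInv : Coeff := AddMonoidAlgebra.single (0, -1) 1

/-- The submodule spanned by the isotopy relations `D - D'` and by the HOMFLY skein relations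
`a L₊ + a⁻¹ L₋ + m L₀`. -/
def skeinRelations (X Y : List Sign) : Submodule Coeff (Diagram X Y →₀ Coeff) :=
  Submodule.span Coeff
    ({x | ∃ D D' : Diagram X Y, Isotopic D D' ∧
        x = Finsupp.single D 1 - Finsupp.single D' 1} ∪
     {x | ∃ Dp Dm Dz : Diagram X Y, SkeinTriple Dp Dm Dz ∧
        x = a • Finsupp.single Dp 1 + aInv • Finsupp.single Dm 1 + m • Finsupp.single Dz 1})

/-- The HOMFLY skein module: linear combinations of oriented tangles with given endpoints,
modulo isotopy and the skein relation. -/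
abbrev SkeinModule (X Y : List Sign) := (Diagram X Y →₀ Coeff) ⧸ skeinRelations X Y

open Classical in
/-- The bracket `⟨w⟩`, the class of the diagram `w` in the skein module. It is `0` if the
orientation `X`, `Y` of the endpoints does not extend to `w`. -/
def bracket (X Y : List Sign) (w : Word) : SkeinModule X Y :=
  if h : IsDiagram X w Y then (skeinRelations X Y).mkQ (Finsupp.single ⟨w, h⟩ 1) else 0

end

/-- The round circle. -/
def unknot : Diagram [] [] :=
  ⟨[⟨[], .birth true, []⟩, ⟨[], .death true, []⟩], rfl, rfl, rfl⟩

/-- `P` is the HOMFLY polynomial of oriented links. -/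
structure IsHomfly (P : Diagram [] [] → Coeff) : Prop where
  isotopy : ∀ D D', Isotopic D D' → P D = P D'
  unknot : P unknot = 1
  skein : ∀ Dp Dm Dz, SkeinTriple Dp Dm Dz → a * P Dp + aInv * P Dm + m * P Dz = 0

/-! ### 4-plats -/

/-- A word in the generators of the braid group on the strands `0, 1, 2, 3`: the letter `(i, true)`
is the crossing `σ` of the strands in positions `i` and `i + 1`, and `(i, false)` its inverse. The
first letter is at the top. -/
abbrev BraidWord := List (Fin 3 × Bool)

/-- The orientations of the four strands below the crossing in positions `i`, `i + 1`. -/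
def swapAt (o : Fin 4 → Sign) (i : Fin 3) : Fin 4 → Sign :=
  o ∘ Equiv.swap i.castSucc i.succ

/-- The orientations of the four strands below the braid `w`, if they are `o` above it. -/
def transport : (Fin 4 → Sign) → BraidWord → (Fin 4 → Sign)
  | o, [] => o
  | o, c :: w => transport (swapAt o c.1) w

/-- The crossings of the braid `w`, its strands being oriented by `o` at the top. -/
def braidDiagram : (Fin 4 → Sign) → BraidWord → Word
  | _, [] => []
  | o, c :: w =>
      ⟨(List.ofFn o).take c.1, .cross c.2 (o c.1.castSucc) (o c.1.succ),
        (List.ofFn o).drop (c.1 + 2)⟩ :: braidDiagram (swapAt o c.1) w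

/-- The plat presentation `q₄(w)` of a rational 2-tangle with its four endpoints at the top: the
braid `w`, and two unlinked arcs joining its bottom ends `0, 1` and `2, 3`. -/
def q4 (o : Fin 4 → Sign) (w : BraidWord) : Word :=
  braidDiagram o w ++
    [⟨[], .death (transport o w 0), [transport o w 2, transport o w 3]⟩,
     ⟨[], .death (transport o w 2), []⟩]

/-- The plat closure `p₄(w)` of `q₄(w)`: two unlinked arcs joining the top ends `0, 1` and `2, 3`
are added. -/
def p4 (o : Fin 4 → Sign) (w : BraidWord) : Word :=
  [⟨[], .birth (o 0), []⟩, ⟨[o 0, o 1], .birth (o 2), []⟩] ++ q4 o w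

/-- The tangle `T₀` without crossings: nested arcs joining `1, 2` and `0, 3`. -/
def tangleZero (o : Fin 4 → Sign) : Word :=
  [⟨[o 0], .death (o 1), [o 3]⟩, ⟨[], .death (o 0), []⟩]

/-- The tangle `T_∞` without crossings: arcs joining `0, 1` and `2, 3`. -/
def tangleInf (o : Fin 4 → Sign) : Word := q4 o []

/-- The tangle `T_x` with one crossing, a crossing `σ` of the two middle strands above the arcs
of `T_∞`. -/
def tangleX (o : Fin 4 → Sign) : Word := q4 o [(1, true)]

/-! ### The alternating standard words and the matrices -/

/-- The position of the crossings of the syllable with index `j` (counted from `0`). The generators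
of the braid group on the strands `1, 2, 3` are `σ₁`, in positions `1, 2`, and `σ₂`, in positions
`2, 3`. -/
def sylPos (j : ℕ) : Fin 3 := if Even j then 1 else 2

/-- The word `σ₁^(ε 0) σ₂^(-ε 1) σ₁^(ε 2) ⋯` with `N` syllables. -/
def altWord (ε : ℕ → ℕ) : ℕ → BraidWord
  | 0 => []
  | j + 1 => altWord ε j ++ List.replicate (ε j) (sylPos j, decide (Even j))

/-- The index `k` of the syllable `j`: `1` if the two strands that cross in it are oriented in
parallel (both down or both up), and `2` otherwise. -/
def sylIndex (o : Fin 4 → Sign) (ε : ℕ → ℕ) (j : ℕ) : ℕ :=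
  if transport o (altWord ε j) (sylPos j).castSucc = transport o (altWord ε j) (sylPos j).succ
  then 1 else 2

noncomputable section

def matA1 : Matrix (Fin 3) (Fin 3) Coeff :=
  !![1, 0, 0;
     0, 0, -aInv ^ 2;
     0, 1, -(aInv * m)]

def matA2 : Matrix (Fin 3) (Fin 3) Coeff :=
  !![1, 0, -(a * m);
     0, 0, -a ^ 2;
     0, 1, 0]

def matB1 : Matrix (Fin 3) (Fin 3) Coeff :=
  !![0, 0, -a ^ 2;
     0, 1, 0;
     1, 0, -(a * m)]

def matB2 : Matrix (Fin 3) (Fin 3) Coeff :=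
  !![0, 0, -aInv ^ 2;
     0, 1, -(aInv * m);
     1, 0, 0]

/-- The matrix `A¹_k`. -/
def matA (k : ℕ) : Matrix (Fin 3) (Fin 3) Coeff := if k = 1 then matA1 else matA2

/-- The matrix `B⁻¹_k`. -/
def matB (k : ℕ) : Matrix (Fin 3) (Fin 3) Coeff := if k = 1 then matB1 else matB2

/-- The product `A^(ε 0) B^(ε 1) A^(ε 2) ⋯` with `N` factors, with indices `k` given by the
orientation of the syllables. -/
def matM (o : Fin 4 → Sign) (ε : ℕ → ℕ) : ℕ → Matrix (Fin 3) (Fin 3) Coeff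
  | 0 => 1
  | j + 1 => matM o ε j *
      (if Even j then matA (sylIndex o ε j) else matB (sylIndex o ε j)) ^ ε j

end

end HomflySkein

open HomflySkein

namespace HomflySkein

/-! ### Diagrams -/

/-! The span of `T₀`, `T_∞`, `T_x` is stable under placing `σ₁` or `σ₂⁻¹` on top, and the columns of
the matrices record what happens to each basic tangle. `σ₁T₀ = T₀` and `σ₂⁻¹T_∞ = T_∞` are first
Reidemeister moves, `σ₁T_∞ = T_x` is the definition, and `σ₂⁻¹T₀ = T_x` slides a strand past a
minimum. Only `σ₁T_x` and `σ₂⁻¹T_x` need the skein relation, applied to the new crossing: reversing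
it gives a second Reidemeister cancellation, and smoothing it gives a basic tangle. Starting from
`T_∞`, with coordinates `(0, 1, 0)`, and adding letters from the bottom up multiplies by one matrix
on the left for each letter.

Orientation is the delicate point. Two endpoints point down and two up, so, up to reversal, there
are three patterns, and each is carried by exactly two of the basic tangles. A column of a matrix is
meaningful only when its tangle carries the pattern below the crossing. The induction therefore also
carries the vanishing of the coefficient of the missing tangle (`Expands`); this makes the
meaningless column harmless and reproduces the vanishing one letter higher (`Expands.sigma`,
`Expands.sigmaInv`).

Capping off is linear. It turns `T₀` and `T_x` into unknots and `T_∞` into two circles, worth `-(a +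
a⁻¹)/m` unknots. A HOMFLY polynomial factors through the skein module, so the bracket identity of
links gives its value. -/

instance IsDiagram.decidable : ∀ X w Y, Decidable (IsDiagram X w Y)
  | X, [], Y => inferInstanceAs (Decidable (X = Y))
  | X, L :: w, Y =>
      have := IsDiagram.decidable L.tgt w Y
      inferInstanceAs (Decidable (X = L.src ∧ IsDiagram L.tgt w Y))

theorem IsDiagram.source_unique {X X' Y : List Sign} {w : Word} (h : IsDiagram X w Y)
    (h' : IsDiagram X' w Y) : X = X' := by
  cases w with
  | nil => exact Eq.trans h (Eq.symm h')
  | cons L w => exact h.1.trans h'.1.symm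

/-- The diagram with the slice `L` added on top. -/
def consDiagram {X Y Z : List Sign} (L : Layer) (hX : X = L.src) (hZ : L.tgt = Z)
    (D : Diagram Z Y) : Diagram X Y :=
  ⟨L :: D.1, hX, hZ ▸ D.2⟩

section Cons

variable {X Y Z : List Sign} (L : Layer) (hX : X = L.src) (hZ : L.tgt = Z)

theorem Step.cons {D D' : Diagram Z Y} (h : Step D D') :
    Step (consDiagram L hX hZ D) (consDiagram L hX hZ D') := by
  obtain ⟨p, l, r, q, u, v, huv, h1, h2⟩ := h
  exact ⟨L :: p, l, r, q, u, v, huv, by simp [consDiagram, h1, plug],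
    by simp [consDiagram, h2, plug]⟩

theorem Isotopic.cons {D D' : Diagram Z Y} (h : Isotopic D D') :
    Isotopic (consDiagram L hX hZ D) (consDiagram L hX hZ D') := by
  induction h with
  | rel _ _ h => exact .rel _ _ (h.cons L hX hZ)
  | refl _ => exact .refl _
  | symm _ _ _ ih => exact .symm _ _ ih
  | trans _ _ _ _ _ ih ih' => exact .trans _ _ _ ih ih'

theorem SkeinTriple.cons {Dp Dm Dz : Diagram Z Y} (h : SkeinTriple Dp Dm Dz) :
    SkeinTriple (consDiagram L hX hZ Dp) (consDiagram L hX hZ Dm) (consDiagram L hX hZ Dz) := by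
  obtain ⟨p, l, r, q, up, um, uz, hu, h1, h2, h3⟩ := h
  exact ⟨L :: p, l, r, q, up, um, uz, hu, by simp [consDiagram, h1, plug],
    by simp [consDiagram, h2, plug], by simp [consDiagram, h3, plug]⟩

/-- Adding the slice `L` on top, as a map of skein modules. -/
noncomputable def consMap : SkeinModule Z Y →ₗ[Coeff] SkeinModule X Y :=
  (skeinRelations Z Y).mapQ (skeinRelations X Y)
    (Finsupp.lmapDomain Coeff Coeff (consDiagram L hX hZ)) <| by
      rw [skeinRelations, Submodule.span_le]
      rintro _ (⟨D, D', h, rfl⟩ | ⟨Dp, Dm, Dz, h, rfl⟩)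
      · refine Submodule.subset_span (.inl ⟨_, _, h.cons L hX hZ, ?_⟩)
        simp only [map_sub, Finsupp.lmapDomain_apply, Finsupp.mapDomain_single]
      · refine Submodule.subset_span (.inr ⟨_, _, _, h.cons L hX hZ, ?_⟩)
        simp only [map_add, map_smul, Finsupp.lmapDomain_apply, Finsupp.mapDomain_single]

theorem consMap_bracket (w : Word) :
    consMap L hX hZ (bracket Z Y w) = bracket X Y (L :: w) := by
  by_cases h : IsDiagram Z w Y
  · have h' : IsDiagram X (L :: w) Y := ⟨hX, hZ ▸ h⟩
    rw [bracket, bracket, dif_pos h, dif_pos h', consMap, Submodule.mkQ_apply]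
    refine (Submodule.mapQ_apply _ _ _ _).trans ?_
    rw [Finsupp.lmapDomain_apply, Finsupp.mapDomain_single]
    rfl
  · have h' : ¬ IsDiagram X (L :: w) Y := fun h' => h (hZ ▸ h'.2)
    rw [bracket, bracket, dif_neg h, dif_neg h', map_zero]

end Cons

/-! ### Brackets -/

section Bracket

variable {X Y : List Sign}

theorem bracket_cons_congr {Z : List Sign} (L : Layer) (hX : X = L.src) (hZ : L.tgt = Z)
    {w w' : Word} (h : bracket Z Y w = bracket Z Y w') :
    bracket X Y (L :: w) = bracket X Y (L :: w') := by
  rw [← consMap_bracket L hX hZ, h, consMap_bracket]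

theorem bracket_eq_of_localMove (p : Word) (l r : List Sign) (q : Word) {u v : Word}
    (huv : LocalMove u v) {w w' : Word} (h : IsDiagram X w Y) (h' : IsDiagram X w' Y)
    (hw : w = plug p l r q u) (hw' : w' = plug p l r q v) : bracket X Y w = bracket X Y w' := by
  rw [bracket, bracket, dif_pos h, dif_pos h', ← sub_eq_zero, ← map_sub, Submodule.mkQ_apply,
    Submodule.Quotient.mk_eq_zero]
  exact Submodule.subset_span
    (.inl ⟨_, _, .rel _ _ ⟨p, l, r, q, u, v, huv, hw, hw'⟩, rfl⟩)

theorem bracket_skein (p : Word) (l r : List Sign) (q : Word) {up um uz : Word}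
    (hu : LocalSkein up um uz) {wp wm wz : Word} (hp : IsDiagram X wp Y) (hm : IsDiagram X wm Y)
    (hz : IsDiagram X wz Y) (hwp : wp = plug p l r q up) (hwm : wm = plug p l r q um)
    (hwz : wz = plug p l r q uz) :
    a • bracket X Y wp + aInv • bracket X Y wm + m • bracket X Y wz = 0 := by
  rw [bracket, bracket, bracket, dif_pos hp, dif_pos hm, dif_pos hz, ← map_smul, ← map_smul,
    ← map_smul, ← map_add, ← map_add, Submodule.mkQ_apply, Submodule.Quotient.mk_eq_zero]
  exact Submodule.subset_span
    (.inr ⟨_, _, _, ⟨p, l, r, q, up, um, uz, hu, hwp, hwm, hwz⟩, rfl⟩)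

/-! ### Solving the skein relation for one of its terms -/

theorem aInv_mul_a : aInv * a = 1 := by
  simp [a, aInv, AddMonoidAlgebra.single_mul_single, AddMonoidAlgebra.one_def, ← Prod.zero_eq_mk]

theorem mInv_mul_m : mInv * m = 1 := by
  simp [m, mInv, AddMonoidAlgebra.single_mul_single, AddMonoidAlgebra.one_def, ← Prod.zero_eq_mk]

section Solve

variable {M : Type*} [AddCommGroup M] [Module Coeff M] {x y z : M}

theorem skein_solve_pos (h : a • x + aInv • y + m • z = 0) :
    x = -(aInv ^ 2) • y + -(aInv * m) • z := by
  have := congrArg (aInv • ·) h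
  simp only [smul_add, smul_smul, aInv_mul_a, one_smul, smul_zero] at this
  rw [← sub_eq_zero, ← this]
  module

theorem skein_solve_neg (h : a • x + aInv • y + m • z = 0) :
    y = -(a ^ 2) • x + -(a * m) • z := by
  have := congrArg (a • ·) h
  simp only [smul_add, smul_smul, mul_comm a aInv, aInv_mul_a, one_smul, smul_zero] at this
  rw [← sub_eq_zero, ← this]
  module

theorem skein_solve_smooth (h : a • x + aInv • x + m • z = 0) :
    z = -((a + aInv) * mInv) • x := by
  have := congrArg (mInv • ·) h
  simp only [smul_add, smul_smul, mInv_mul_m, one_smul, smul_zero] at this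
  rw [← sub_eq_zero, ← this]
  module

end Solve
end Bracket


/-! ### Matrices of braid words -/

section WordMatrix

/-- The matrix of the letter `σ₁` or `σ₂⁻¹`, the strands being oriented by `o` above it. -/
noncomputable def letterMatrix (o : Fin 4 → Sign) (c : Fin 3 × Bool) :
    Matrix (Fin 3) (Fin 3) Coeff :=
  (if c.2 then matA else matB) (if o c.1.castSucc = o c.1.succ then 1 else 2)

/-- The product of the matrices of the letters of a braid word. -/
noncomputable def wordMatrix : (Fin 4 → Sign) → BraidWord → Matrix (Fin 3) (Fin 3) Coeff
  | _, [] => 1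
  | o, c :: w => letterMatrix o c * wordMatrix (swapAt o c.1) w

theorem wordMatrix_append (o : Fin 4 → Sign) (u v : BraidWord) :
    wordMatrix o (u ++ v) = wordMatrix o u * wordMatrix (transport o u) v := by
  induction u generalizing o with
  | nil => simp [wordMatrix, transport]
  | cons c u ih => simp [wordMatrix, transport, ih, Matrix.mul_assoc]

/-- Being parallel is symmetric in the two strands, so the index `k` is constant along a syllable
and the syllable contributes a power of one matrix. -/
theorem letterMatrix_swapAt (o : Fin 4 → Sign) (c : Fin 3 × Bool) :
    letterMatrix (swapAt o c.1) c = letterMatrix o c := by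
  simp [letterMatrix, swapAt, eq_comm (a := o c.1.succ)]

theorem wordMatrix_replicate (o : Fin 4 → Sign) (c : Fin 3 × Bool) (e : ℕ) :
    wordMatrix o (List.replicate e c) = letterMatrix o c ^ e := by
  induction e generalizing o with
  | zero => rfl
  | succ e ih => rw [List.replicate_succ, wordMatrix, ih, letterMatrix_swapAt, pow_succ']

theorem matM_eq_wordMatrix (o : Fin 4 → Sign) (ε : ℕ → ℕ) (N : ℕ) :
    matM o ε N = wordMatrix o (altWord ε N) := by
  induction N with
  | zero => rfl
  | succ j ih =>
    rw [matM, altWord, wordMatrix_append, wordMatrix_replicate, ih]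
    by_cases hj : Even j <;> simp [letterMatrix, sylIndex, hj]

theorem mem_altWord {ε : ℕ → ℕ} {N : ℕ} {c : Fin 3 × Bool} (h : c ∈ altWord ε N) :
    c = (1, true) ∨ c = (2, false) := by
  induction N with
  | zero => simp [altWord] at h
  | succ j ih =>
    rcases List.mem_append.1 h with h | h
    · exact ih h
    · rw [List.eq_of_mem_replicate h]
      by_cases hj : Even j <;> simp [sylPos, hj]

end WordMatrix

/-! ### The basic tangles below one crossing -/

section Crossing

variable (p q : Sign)

theorem bracket_sigma_tangleZero :
    bracket [p, q, !q, !p] [] (⟨[p], .cross true q (!q), [!p]⟩ :: tangleZero ![p, !q, q, !p]) =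
      bracket [p, q, !q, !p] [] (tangleZero ![p, q, !q, !p]) := by
  -- With concrete signs double negations reduce, `decide` checks the diagrams, and `rfl` exhibits
  -- them as plugged local moves; the later case splits serve the same purpose.
  cases p <;> cases q <;>
  exact bracket_eq_of_localMove [] [_] [_] [⟨[], .death _, []⟩] (.r1_death true _)
    (by decide) (by decide) rfl rfl

theorem bracket_sigmaInv_tangleInf :
    bracket [p, !p, q, !q] []
        (⟨[p, !p], .cross false q (!q), []⟩ :: tangleInf ![p, !p, !q, q]) =
      bracket [p, !p, q, !q] [] (tangleInf ![p, !p, q, !q]) := by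
  trans bracket [p, !p, q, !q] []
    -- The left minimum is raised above the crossing, which then sits directly on its own minimum as
    -- a removable curl.
    [⟨[], .death p, [q, !q]⟩, ⟨[], .cross false q (!q), []⟩, ⟨[], .death (!q), []⟩]
  · cases p <;> cases q <;>
    exact (bracket_eq_of_localMove [] [] [] [⟨[], .death _, []⟩]
      (.interchange (.death _) (.cross false _ _) []) (by decide) (by decide) rfl rfl).symm
  · cases p <;> cases q <;>
    exact bracket_eq_of_localMove [⟨[], .death _, [_, _]⟩] [] [] [] (.r1_death false _)
      (by decide) (by decide) rfl rfl

/-- The strand from endpoint 3 slides past the minimum of the inner arc of `T₀`, which turns `σ₂⁻¹`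
into `σ₁`; the two minima then exchange heights. -/
theorem bracket_sigmaInv_tangleZero :
    bracket [p, q, !p, !q] []
        (⟨[p, q], .cross false (!p) (!q), []⟩ :: tangleZero ![p, q, !q, !p]) =
      bracket [p, q, !p, !q] [] (tangleX ![p, q, !p, !q]) := by
  trans bracket [p, q, !p, !q] []
    [⟨[p], .cross true q (!p), [!q]⟩, ⟨[p, !p], .death q, []⟩, ⟨[], .death p, []⟩]
  · cases p <;> cases q <;>
    exact (bracket_eq_of_localMove [] [_] [] [⟨[], .death _, []⟩]
      (.slide_death true _ _) (by decide) (by decide) rfl rfl).symm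
  · cases p <;> cases q <;>
    exact (bracket_eq_of_localMove [⟨[_], .cross true _ _, [_]⟩] [] [] []
      (.interchange (.death _) (.death _) []) (by decide) (by decide) rfl rfl).symm

theorem bracket_sigma_tangleX_parallel :
    bracket [p, !p, !p, p] [] (⟨[p], .cross true (!p) (!p), [p]⟩ :: tangleX ![p, !p, !p, p]) =
      -(aInv ^ 2) • bracket [p, !p, !p, p] [] (tangleInf ![p, !p, !p, p]) +
        -(aInv * m) • bracket [p, !p, !p, p] [] (tangleX ![p, !p, !p, p]) := by
  have hcancel : bracket [p, !p, !p, p] []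
      (⟨[p], .cross false (!p) (!p), [p]⟩ :: tangleX ![p, !p, !p, p]) =
      bracket [p, !p, !p, p] [] (tangleInf ![p, !p, !p, p]) := by
    cases p <;>
    exact bracket_eq_of_localMove [] [_] [_]
      [⟨[], .death _, [_, _]⟩, ⟨[], .death _, []⟩] (.r2 false _ _) (by decide) (by decide) rfl rfl
  rw [← hcancel]
  apply skein_solve_pos
  cases p <;>
  exact bracket_skein [] [_] [_] (tangleX ![_, _, _, _]) (.parallel _)
    (by decide) (by decide) (by decide) rfl rfl rfl

/-- An antiparallel `σ` is a negative crossing. Its smoothing leaves a curl on a maximum, and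
removing the curl and straightening the arc gives `T₀`. -/
theorem bracket_sigma_tangleX_antiparallel :
    bracket [p, !p, p, !p] [] (⟨[p], .cross true (!p) p, [!p]⟩ :: tangleX ![p, p, !p, !p]) =
      -(a ^ 2) • bracket [p, !p, p, !p] [] (tangleInf ![p, !p, p, !p]) +
        -(a * m) • bracket [p, !p, p, !p] [] (tangleZero ![p, !p, p, !p]) := by
  have hcancel : bracket [p, !p, p, !p] []
      (⟨[p], .cross false (!p) p, [!p]⟩ :: tangleX ![p, p, !p, !p]) =
      bracket [p, !p, p, !p] [] (tangleInf ![p, !p, p, !p]) := by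
    cases p <;>
    exact bracket_eq_of_localMove [] [_] [_]
      [⟨[], .death _, [_, _]⟩, ⟨[], .death _, []⟩] (.r2 false _ _) (by decide) (by decide) rfl rfl
  have hsmooth : bracket [p, !p, p, !p] []
      (⟨[p], .death (!p), [!p]⟩ :: ⟨[p], .birth p, [!p]⟩ :: tangleX ![p, p, !p, !p]) =
      bracket [p, !p, p, !p] [] (tangleZero ![p, !p, p, !p]) := by
    trans bracket [p, !p, p, !p] []
      (⟨[p], .death (!p), [!p]⟩ :: ⟨[p], .birth (!p), [!p]⟩ :: tangleInf ![p, !p, p, !p])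
    · cases p <;>
      exact bracket_eq_of_localMove [⟨[_], .death _, [_]⟩] [_] [_]
        [⟨[], .death _, [_, _]⟩, ⟨[], .death _, []⟩] (.r1_birth true _)
        (by decide) (by decide) rfl rfl
    · cases p <;>
      exact bracket_eq_of_localMove [⟨[_], .death _, [_]⟩] [] [_]
        [⟨[], .death _, []⟩] (.zigzag_right _) (by decide) (by decide) rfl rfl
  rw [← hcancel, ← hsmooth]
  apply skein_solve_neg
  cases p <;>
  exact bracket_skein [] [_] [_] (tangleX ![_, _, _, _]) (.antiparallel _)
    (by decide) (by decide) (by decide) rfl rfl rfl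

theorem bracket_sigmaInv_tangleX_parallel :
    bracket [p, p, !p, !p] []
        (⟨[p, p], .cross false (!p) (!p), []⟩ :: tangleX ![p, p, !p, !p]) =
      -(a ^ 2) • bracket [p, p, !p, !p] [] (tangleZero ![p, p, !p, !p]) +
        -(a * m) • bracket [p, p, !p, !p] [] (tangleX ![p, p, !p, !p]) := by
  -- Rewriting `T_x` as `σ₂⁻¹T₀` puts two crossings in the same position, so that changing the upper
  -- one cancels both.
  have hslide := bracket_sigmaInv_tangleZero p p
  have hcancel : bracket [p, p, !p, !p] [] (⟨[p, p], .cross true (!p) (!p), []⟩ ::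
        ⟨[p, p], .cross false (!p) (!p), []⟩ :: tangleZero ![p, p, !p, !p]) =
      bracket [p, p, !p, !p] [] (tangleZero ![p, p, !p, !p]) := by
    cases p <;>
    exact bracket_eq_of_localMove [] [_, _] [] (tangleZero ![_, _, _, _]) (.r2 true _ _)
      (by decide) (by decide) rfl rfl
  rw [← bracket_cons_congr (X := [p, p, !p, !p]) ⟨[p, p], .cross false (!p) (!p), []⟩ rfl rfl hslide,
    ← hslide]
  rw [← hcancel]
  apply skein_solve_neg
  cases p <;>
  exact bracket_skein [] [_, _] [] (⟨[_, _], .cross false _ _, []⟩ :: tangleZero ![_, _, _, _])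
    (.parallel _) (by decide) (by decide) (by decide) rfl rfl rfl

theorem bracket_sigmaInv_tangleX_antiparallel :
    bracket [p, !p, p, !p] []
        (⟨[p, !p], .cross false p (!p), []⟩ :: tangleX ![p, !p, !p, p]) =
      -(aInv ^ 2) • bracket [p, !p, p, !p] [] (tangleZero ![p, !p, p, !p]) +
        -(aInv * m) • bracket [p, !p, p, !p] [] (tangleInf ![p, !p, p, !p]) := by
  have hslide : bracket [p, !p, !p, p] []
        (⟨[p, !p], .cross false (!p) p, []⟩ :: tangleZero ![p, !p, p, !p]) =
      bracket [p, !p, !p, p] [] (tangleX ![p, !p, !p, p]) := by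
    cases p <;> exact bracket_sigmaInv_tangleZero _ _
  have hcancel : bracket [p, !p, p, !p] [] (⟨[p, !p], .cross true p (!p), []⟩ ::
        ⟨[p, !p], .cross false (!p) p, []⟩ :: tangleZero ![p, !p, p, !p]) =
      bracket [p, !p, p, !p] [] (tangleZero ![p, !p, p, !p]) := by
    cases p <;>
    exact bracket_eq_of_localMove [] [_, _] [] (tangleZero ![_, _, _, _]) (.r2 true _ _)
      (by decide) (by decide) rfl rfl
  have hsmooth : bracket [p, !p, p, !p] [] (⟨[p, !p], .death p, []⟩ ::
        ⟨[p, !p], .birth (!p), []⟩ :: ⟨[p, !p], .cross false (!p) p, []⟩ ::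
          tangleZero ![p, !p, p, !p]) =
      bracket [p, !p, p, !p] [] (tangleInf ![p, !p, p, !p]) := by
    trans bracket [p, !p, p, !p] [] (⟨[p, !p], .death p, []⟩ ::
        ⟨[p, !p], .birth p, []⟩ :: tangleZero ![p, !p, p, !p])
    · cases p <;>
      exact bracket_eq_of_localMove [⟨[_, _], .death _, []⟩] [_, _] [] (tangleZero ![_, _, _, _])
        (.r1_birth false _) (by decide) (by decide) rfl rfl
    trans bracket [p, !p, p, !p] [] [⟨[p, !p], .death p, []⟩, ⟨[], .death p, []⟩]
    · cases p <;>
      exact bracket_eq_of_localMove [⟨[_, _], .death _, []⟩] [_] [] [⟨[], .death _, []⟩]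
        (.zigzag_right _) (by decide) (by decide) rfl rfl
    · cases p <;>
      exact (bracket_eq_of_localMove [] [] [] [] (.interchange (.death _) (.death _) [])
        (by decide) (by decide) rfl rfl).symm
  rw [← bracket_cons_congr (X := [p, !p, p, !p]) ⟨[p, !p], .cross false p (!p), []⟩ rfl rfl hslide,
    ← hsmooth]
  rw [← hcancel]
  apply skein_solve_pos
  cases p <;>
  exact bracket_skein [] [_, _] [] (⟨[_, _], .cross false _ _, []⟩ :: tangleZero ![_, _, _, _])
    (.antiparallel _) (by decide) (by decide) (by decide) rfl rfl rfl

end Crossing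

/-! ### Closures of the basic tangles -/

section Closure

variable (p q : Sign)

/-- The two unlinked arcs above the plat closure of a tangle. -/
def platCap : Word := [⟨[], .birth p, []⟩, ⟨[p, !p], .birth q, []⟩]

/-- A curl inserted at the maximum and removed at the minimum reverses the orientation of the
circle. -/
theorem bracket_circle :
    bracket [] [] [⟨[], .birth p, []⟩, ⟨[], .death p, []⟩] = bracket [] [] unknot.1 := by
  cases p
  · trans bracket [] []
      [⟨[], .birth true, []⟩, ⟨[], .cross true true false, []⟩, ⟨[], .death false, []⟩]
    · exact (bracket_eq_of_localMove [] [] [] [⟨[], .death _, []⟩] (.r1_birth true true)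
        (by decide) (by decide) rfl rfl).symm
    · exact bracket_eq_of_localMove [⟨[], .birth _, []⟩] [] [] [] (.r1_death true true)
        (by decide) (by decide) rfl rfl
  · rfl

/-- The skein relation at the crossing of a curled circle: both signs give the unknot, and the
smoothing gives two circles. -/
theorem bracket_two_circles :
    bracket [] [] [⟨[], .birth p, []⟩, ⟨[], .death p, []⟩, ⟨[], .birth q, []⟩, ⟨[], .death q, []⟩] =
      -((a + aInv) * mInv) • bracket [] [] unknot.1 := by
  have hreverse : bracket [] []
        [⟨[], .birth p, []⟩, ⟨[], .death p, []⟩, ⟨[], .birth q, []⟩, ⟨[], .death q, []⟩] =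
      bracket [] []
        [⟨[], .birth p, []⟩, ⟨[], .death p, []⟩, ⟨[], .birth (!p), []⟩, ⟨[], .death (!p), []⟩] := by
    refine bracket_cons_congr ⟨[], .birth p, []⟩ rfl rfl ?_
    refine bracket_cons_congr ⟨[], .death p, []⟩ rfl rfl ?_
    exact (bracket_circle q).trans (bracket_circle (!p)).symm
  have hcurl (e : Bool) : bracket [] []
      [⟨[], .birth p, []⟩, ⟨[], .cross e p (!p), []⟩, ⟨[], .death (!p), []⟩] =
      bracket [] [] unknot.1 := by
    rw [← bracket_circle p]
    cases p <;>
    exact bracket_eq_of_localMove [⟨[], .birth _, []⟩] [] [] [] (.r1_death e _)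
      (by cases e <;> decide) (by decide) rfl rfl
  rw [hreverse]
  apply skein_solve_smooth
  -- An antiparallel `cross false` is positive, so the first unknot becomes `L₊` and the second
  -- `L₋`.
  nth_rw 1 [← hcurl false]
  rw [← hcurl true]
  cases p <;>
  exact bracket_skein [⟨[], .birth _, []⟩] [] [] [⟨[], .death _, []⟩] (.antiparallel _)
    (by decide) (by decide) (by decide) rfl rfl rfl

theorem bracket_platCap_tangleInf :
    bracket [] [] (platCap p q ++ tangleInf ![p, !p, q, !q]) =
      -((a + aInv) * mInv) • bracket [] [] unknot.1 := by
  rw [← bracket_two_circles p q]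
  cases p <;> cases q <;>
  exact (bracket_eq_of_localMove [⟨[], .birth _, []⟩] [] [] [⟨[], .death _, []⟩]
    (.interchange (.death _) (.birth _) []) (by decide) (by decide) rfl rfl).symm

theorem bracket_platCap_tangleZero :
    bracket [] [] (platCap p p ++ tangleZero ![p, !p, p, !p]) = bracket [] [] unknot.1 := by
  rw [← bracket_circle p]
  cases p <;>
  exact bracket_eq_of_localMove [⟨[], .birth _, []⟩] [_] [] [⟨[], .death _, []⟩]
    (.zigzag_right _) (by decide) (by decide) rfl rfl

/-- Seen as `σ₂⁻¹T₀`, the crossing of `T_x` is a curl on the right maximum; removing it reduces to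
the closure of `T₀`. -/
theorem bracket_platCap_tangleX :
    bracket [] [] (platCap p (!p) ++ tangleX ![p, !p, !p, p]) = bracket [] [] unknot.1 := by
  have hslide : bracket [p, !p, !p, p] []
        (⟨[p, !p], .cross false (!p) p, []⟩ :: tangleZero ![p, !p, p, !p]) =
      bracket [p, !p, !p, p] [] (tangleX ![p, !p, !p, p]) := by
    cases p <;> exact bracket_sigmaInv_tangleZero _ _
  trans bracket [] [] (platCap p (!p) ++
    ⟨[p, !p], .cross false (!p) p, []⟩ :: tangleZero ![p, !p, p, !p])
  · refine bracket_cons_congr ⟨[], .birth p, []⟩ rfl rfl ?_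
    refine bracket_cons_congr ⟨[p, !p], .birth (!p), []⟩ rfl rfl ?_
    cases p <;> exact hslide.symm
  rw [← bracket_platCap_tangleZero p]
  cases p <;>
  exact bracket_eq_of_localMove [⟨[], .birth _, []⟩] [_, _] [] (tangleZero ![_, _, _, _])
    (.r1_birth false _) (by decide) (by decide) rfl rfl

end Closure


/-! ### Expansion in the basic tangles -/

/-- Two of the four endpoints go down, and two go up. -/
inductive Balanced : Sign → Sign → Sign → Sign → Prop
  | adjacent (p : Sign) : Balanced p p (!p) (!p)
  | alternating (p : Sign) : Balanced p (!p) p (!p)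
  | nested (p : Sign) : Balanced p (!p) (!p) p

theorem Balanced.swap_middle {p q r s : Sign} (h : Balanced p q r s) : Balanced p r q s := by
  cases h
  · exact .alternating p
  · exact .adjacent p
  · exact .nested p

theorem Balanced.swap_right {p q r s : Sign} (h : Balanced p q r s) : Balanced p q s r := by
  cases h
  · exact .adjacent p
  · exact .nested p
  · exact .alternating p

/-- The bracket of the tangle `T` has the coefficients `v` in the basic tangles, and only the basic
tangles that carry the orientation `p`, `q`, `r`, `s` of the endpoints occur. -/
structure Expands (p q r s : Sign) (T : Word) (v : Fin 3 → Coeff) : Prop where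
  bracket_eq : bracket [p, q, r, s] [] T =
    v 0 • bracket [p, q, r, s] [] (tangleZero ![p, q, r, s]) +
      v 1 • bracket [p, q, r, s] [] (tangleInf ![p, q, r, s]) +
      v 2 • bracket [p, q, r, s] [] (tangleX ![p, q, r, s])
  zero : ¬ IsDiagram [p, q, r, s] (tangleZero ![p, q, r, s]) [] → v 0 = 0
  inf : ¬ IsDiagram [p, q, r, s] (tangleInf ![p, q, r, s]) [] → v 1 = 0
  x : ¬ IsDiagram [p, q, r, s] (tangleX ![p, q, r, s]) [] → v 2 = 0

theorem Expands.bracket_cons {p q r s : Sign} {T : Word} {v : Fin 3 → Coeff}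
    (h : Expands p q r s T v) {X : List Sign} (L : Layer) (hX : X = L.src)
    (hZ : L.tgt = [p, q, r, s]) :
    bracket X [] (L :: T) = v 0 • bracket X [] (L :: tangleZero ![p, q, r, s]) +
      v 1 • bracket X [] (L :: tangleInf ![p, q, r, s]) +
      v 2 • bracket X [] (L :: tangleX ![p, q, r, s]) := by
  rw [← consMap_bracket L hX hZ, h.bracket_eq]
  simp only [map_add, map_smul, consMap_bracket]

theorem swapAt_one (p q r s : Sign) : swapAt ![p, q, r, s] 1 = ![p, r, q, s] := by
  revert p q r s
  decide

theorem swapAt_two (p q r s : Sign) : swapAt ![p, q, r, s] 2 = ![p, q, s, r] := by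
  revert p q r s
  decide

theorem matA1_mulVec (v : Fin 3 → Coeff) :
    matA1.mulVec v = ![v 0, -(aInv ^ 2) * v 2, v 1 + -(aInv * m) * v 2] := by
  ext1 i; fin_cases i <;> simp [matA1, Matrix.mulVec, dotProduct, Fin.sum_univ_three]

theorem matA2_mulVec (v : Fin 3 → Coeff) :
    matA2.mulVec v = ![v 0 + -(a * m) * v 2, -(a ^ 2) * v 2, v 1] := by
  ext1 i; fin_cases i <;> simp [matA2, Matrix.mulVec, dotProduct, Fin.sum_univ_three]

theorem matB1_mulVec (v : Fin 3 → Coeff) :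
    matB1.mulVec v = ![-(a ^ 2) * v 2, v 1, v 0 + -(a * m) * v 2] := by
  ext1 i; fin_cases i <;> simp [matB1, Matrix.mulVec, dotProduct, Fin.sum_univ_three]

theorem matB2_mulVec (v : Fin 3 → Coeff) :
    matB2.mulVec v = ![-(aInv ^ 2) * v 2, v 1 + -(aInv * m) * v 2, v 0] := by
  ext1 i; fin_cases i <;> simp [matB2, Matrix.mulVec, dotProduct, Fin.sum_univ_three]

theorem tangleX_eq (p q r s : Sign) :
    tangleX ![p, q, r, s] = ⟨[p], .cross true q r, [s]⟩ :: tangleInf ![p, r, q, s] := by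
  rw [← swapAt_one]
  rfl

/-- Below the crossing the missing tangle is `T_x`, `T_∞`, `T₀` in the three cases. The first two
share `matA2`, each using only the columns of the tangles that are present. -/
theorem Expands.sigma {p q r s : Sign} (ho : Balanced p q r s) {T : Word} {v : Fin 3 → Coeff}
    (h : Expands p r q s T v) :
    Expands p q r s (⟨[p], .cross true q r, [s]⟩ :: T)
      ((letterMatrix ![p, q, r, s] (1, true)).mulVec v) := by
  have hb := h.bracket_cons (X := [p, q, r, s]) ⟨[p], .cross true q r, [s]⟩ rfl rfl
  rw [← tangleX_eq] at hb
  cases ho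
  · have hM : letterMatrix ![p, p, !p, !p] (1, true) = matA2 := by
      cases p <;> simp [letterMatrix, matA]
    have hv : v 2 = 0 := h.x (by cases p <;> decide)
    rw [hM, matA2_mulVec, hv]
    refine ⟨hb.trans ?_, fun h => absurd ?_ h, fun _ => by simp, fun h => absurd ?_ h⟩
    · have h1 := bracket_sigma_tangleZero p p
      simp [hv, h1]
    all_goals cases p <;> decide
  · have hM : letterMatrix ![p, !p, p, !p] (1, true) = matA2 := by
      cases p <;> simp [letterMatrix, matA]
    have hv : v 1 = 0 := h.inf (by cases p <;> decide)
    rw [hM, matA2_mulVec, hv]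
    refine ⟨hb.trans ?_, fun h => absurd ?_ h, fun h => absurd ?_ h, fun _ => rfl⟩
    · have h1 := bracket_sigma_tangleZero p (!p)
      rw [Bool.not_not] at h1
      rw [h1, bracket_sigma_tangleX_antiparallel, hv]
      simp only [Matrix.cons_val]
      module
    all_goals cases p <;> decide
  · have hM : letterMatrix ![p, !p, !p, p] (1, true) = matA1 := by
      cases p <;> simp [letterMatrix, matA]
    have hv : v 0 = 0 := h.zero (by cases p <;> decide)
    rw [hM, matA1_mulVec, hv]
    refine ⟨hb.trans ?_, fun _ => rfl, fun h => absurd ?_ h, fun h => absurd ?_ h⟩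
    · rw [bracket_sigma_tangleX_parallel, hv]
      simp only [Matrix.cons_val]
      module
    all_goals cases p <;> decide

theorem Expands.sigmaInv {p q r s : Sign} (ho : Balanced p q r s) {T : Word} {v : Fin 3 → Coeff}
    (h : Expands p q s r T v) :
    Expands p q r s (⟨[p, q], .cross false r s, []⟩ :: T)
      ((letterMatrix ![p, q, r, s] (2, false)).mulVec v) := by
  have hb := h.bracket_cons (X := [p, q, r, s]) ⟨[p, q], .cross false r s, []⟩ rfl rfl
  cases ho
  · have hM : letterMatrix ![p, p, !p, !p] (2, false) = matB1 := by
      cases p <;> simp [letterMatrix, matB]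
    have hv : v 1 = 0 := h.inf (by cases p <;> decide)
    rw [hM, matB1_mulVec, hv]
    refine ⟨hb.trans ?_, fun h => absurd ?_ h, fun _ => rfl, fun h => absurd ?_ h⟩
    · rw [bracket_sigmaInv_tangleZero, bracket_sigmaInv_tangleX_parallel, hv]
      simp only [Matrix.cons_val]
      module
    all_goals cases p <;> decide
  · have hM : letterMatrix ![p, !p, p, !p] (2, false) = matB2 := by
      cases p <;> simp [letterMatrix, matB]
    have hv : v 0 = 0 := h.zero (by cases p <;> decide)
    rw [hM, matB2_mulVec, hv]
    refine ⟨hb.trans ?_, fun h => absurd ?_ h, fun h => absurd ?_ h, fun _ => rfl⟩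
    · rw [bracket_sigmaInv_tangleInf, bracket_sigmaInv_tangleX_antiparallel, hv]
      simp only [Matrix.cons_val]
      module
    all_goals cases p <;> decide
  · have hM : letterMatrix ![p, !p, !p, p] (2, false) = matB2 := by
      cases p <;> simp [letterMatrix, matB]
    have hv : v 2 = 0 := h.x (by cases p <;> decide)
    rw [hM, matB2_mulVec, hv]
    refine ⟨hb.trans ?_, fun _ => by simp, fun h => absurd ?_ h, fun h => absurd ?_ h⟩
    · have h1 := bracket_sigmaInv_tangleZero p (!p)
      have h2 := bracket_sigmaInv_tangleInf p (!p)
      rw [Bool.not_not] at h1 h2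
      rw [h1, h2, hv]
      simp only [Matrix.cons_val]
      module
    all_goals cases p <;> decide

theorem balanced_and_expands_q4 (w : BraidWord) (hw : ∀ c ∈ w, c = (1, true) ∨ c = (2, false))
    (p q r s : Sign) (h : IsDiagram [p, q, r, s] (q4 ![p, q, r, s] w) []) :
    Balanced p q r s ∧ Expands p q r s (q4 ![p, q, r, s] w)
      ((wordMatrix ![p, q, r, s] w).mulVec ![0, 1, 0]) := by
  induction w generalizing p q r s with
  | nil =>
    constructor
    · have hp : q = !p := by revert h; revert p q r s; decide
      have hr : s = !r := by revert h; revert p q r s; decide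
      subst hp hr
      cases p <;> cases r
      exacts [.alternating _, .nested _, .nested _, .alternating _]
    · rw [wordMatrix, Matrix.one_mulVec]
      refine ⟨?_, fun _ => rfl, fun h' => absurd h h', fun _ => rfl⟩
      simp [tangleInf]
  | cons c w ih =>
    rw [wordMatrix, ← Matrix.mulVec_mulVec]
    rcases hw c (by simp) with rfl | rfl
    · have hq : q4 ![p, q, r, s] ((1, true) :: w) =
          ⟨[p], .cross true q r, [s]⟩ :: q4 ![p, r, q, s] w := by
        rw [← swapAt_one p q r s]
        rfl
      rw [hq] at h ⊢
      obtain ⟨hbal, hexp⟩ := ih (fun c hc => hw c (by simp [hc])) p r q s h.2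
      rw [swapAt_one]
      exact ⟨hbal.swap_middle, hexp.sigma hbal.swap_middle⟩
    · have hq : q4 ![p, q, r, s] ((2, false) :: w) =
          ⟨[p, q], .cross false r s, []⟩ :: q4 ![p, q, s, r] w := by
        rw [← swapAt_two p q r s]
        rfl
      rw [hq] at h ⊢
      obtain ⟨hbal, hexp⟩ := ih (fun c hc => hw c (by simp [hc])) p q s r h.2
      rw [swapAt_two]
      exact ⟨hbal.swap_right, hexp.sigmaInv hbal.swap_right⟩

/-! ### The plat closure -/

theorem Expands.bracket_platCap {p q : Sign} {T : Word} {v : Fin 3 → Coeff}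
    (h : Expands p (!p) q (!q) T v) :
    bracket [] [] (platCap p q ++ T) =
      (v 0 - v 1 * ((a + aInv) * mInv) + v 2) • bracket [] [] unknot.1 := by
  -- Capping off adds two slices, hence is a composite of two linear maps.
  obtain ⟨cap, hcap⟩ : ∃ cap : SkeinModule [p, !p, q, !q] [] →ₗ[Coeff] SkeinModule [] [],
      ∀ T', bracket [] [] (platCap p q ++ T') = cap (bracket [p, !p, q, !q] [] T') :=
    ⟨consMap (X := []) (Z := [p, !p]) ⟨[], .birth p, []⟩ rfl rfl ∘ₗ
      consMap (X := [p, !p]) (Z := [p, !p, q, !q]) ⟨[p, !p], .birth q, []⟩ rfl rfl,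
      fun T' => ((congrArg _ (consMap_bracket _ _ _ T')).trans (consMap_bracket _ _ _ _)).symm⟩
  rw [hcap, h.bracket_eq]
  simp only [map_add, map_smul]
  rw [← hcap, ← hcap, ← hcap, bracket_platCap_tangleInf]
  -- The endpoints are alternating or nested, so `T_x` or `T₀` respectively is missing and needs no
  -- closure.
  obtain rfl | rfl : q = p ∨ q = !p := by cases p <;> cases q <;> simp
  · have hv : v 2 = 0 := h.x (by cases q <;> decide)
    rw [bracket_platCap_tangleZero, hv]
    module
  · have hv : v 0 = 0 := h.zero (by cases p <;> decide)
    rw [hv, Bool.not_not, bracket_platCap_tangleX]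
    module

/-! ### Evaluation of link invariants, and the theorem -/

/-- The linear extension of an invariant of links that satisfies the skein relation. -/
noncomputable def IsHomfly.lift {P : Diagram [] [] → Coeff} (hP : IsHomfly P) :
    SkeinModule [] [] →ₗ[Coeff] Coeff :=
  (skeinRelations [] []).liftQ (Finsupp.linearCombination Coeff P) <| by
    rw [skeinRelations, Submodule.span_le]
    rintro _ (⟨D, D', h, rfl⟩ | ⟨Dp, Dm, Dz, h, rfl⟩)
    · simp [hP.isotopy D D' h]
    · simpa using hP.skein Dp Dm Dz h

theorem IsHomfly.lift_bracket {P : Diagram [] [] → Coeff} (hP : IsHomfly P) {w : Word}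
    (h : IsDiagram [] w []) : hP.lift (bracket [] [] w) = P ⟨w, h⟩ := by
  rw [bracket, dif_pos h, lift, Submodule.mkQ_apply]
  exact (Submodule.liftQ_apply _ _ _).trans (by simp)

end HomflySkein
open HomflySkein
theorem theorem2 (n : ℕ) (hn : 1 ≤ n) (ε : ℕ → ℕ) (hε : ∀ i < 2 * n - 1, 0 < ε i)
    (w : BraidWord) (hw : w = altWord ε (2 * n - 1))
    (o : Fin 4 → Sign) (hT : IsDiagram (List.ofFn o) (q4 o w) [])
    (f g h : Coeff)
    (hfgh : ![f, g, h] = Matrix.vecMul ![0, 1, 0] (matM o ε (2 * n - 1)).transpose) :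
    -- the bracket expansion of the oriented tangle
    bracket (List.ofFn o) [] (q4 o w) =
        f • bracket (List.ofFn o) [] (tangleZero o) +
        g • bracket (List.ofFn o) [] (tangleInf o) +
        h • bracket (List.ofFn o) [] (tangleX o) ∧
    -- only basic tangles that carry the orientation of the endpoints occur
    (¬ IsDiagram (List.ofFn o) (tangleZero o) [] → f = 0) ∧
    (¬ IsDiagram (List.ofFn o) (tangleInf o) [] → g = 0) ∧
    (¬ IsDiagram (List.ofFn o) (tangleX o) [] → h = 0) ∧
    -- the plat closure, if the orientation extends to it
    (∀ hK : IsDiagram [] (p4 o w) [],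
      bracket [] [] (p4 o w) = (f - g * ((a + aInv) * mInv) + h) • bracket [] [] unknot.1 ∧
      ∀ P : Diagram [] [] → Coeff, IsHomfly P →
        P ⟨p4 o w, hK⟩ = f - g * ((a + aInv) * mInv) + h) := by
  obtain ⟨p, q, r, s, rfl⟩ : ∃ p q r s, o = ![p, q, r, s] :=
    ⟨o 0, o 1, o 2, o 3, by ext i; fin_cases i <;> rfl⟩
  have hlist : List.ofFn ![p, q, r, s] = [p, q, r, s] := by simp
  rw [Matrix.vecMul_transpose, matM_eq_wordMatrix, ← hw] at hfgh
  rw [hlist] at hT ⊢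
  have hexp := (balanced_and_expands_q4 w (fun c hc => mem_altWord (hw ▸ hc)) p q r s hT).2
  rw [← hfgh] at hexp
  refine ⟨hexp.bracket_eq, hexp.zero, hexp.inf, hexp.x, fun hK => ?_⟩
  -- The caps join endpoints `0, 1` and `2, 3`, which forces opposite signs in each pair.
  have hpq : [p, q] = [p, !p] := hK.2.1.symm
  obtain rfl : q = !p := by simpa using hpq
  have hrs : [p, !p, r, !r] = [p, !p, r, s] := hK.2.2.source_unique hT
  obtain rfl : s = !r := by simpa using hrs.symm
  have hb : bracket [] [] (p4 ![p, !p, r, !r] w) =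
      (f - g * ((a + aInv) * mInv) + h) • bracket [] [] unknot.1 := hexp.bracket_platCap
  refine ⟨hb, fun P hP => ?_⟩
  rw [← hP.lift_bracket hK, hb, map_smul, hP.lift_bracket unknot.2]
  simp [hP.unknot]
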